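/- Let $G$ be a compact Hausdorff group with normalized Haar measure $\mu$ and let $\mathcal A$ be a complex Banach algebra (not necessarily unital). Let $L^1(G,\mathcal A)$ be the Banach algebra of Bochner integrable functions under convolution $(\varphi*\psi)(t)=\int_G\varphi(s)\psi(s^{-1}t)\,d\mu(s)$. Let $L^\infty(G,\mathcal A^*)$ be the space of essentially bounded strongly measurable functions $G\to\mathcal A^*$, regarded as a subspace of $L^1(G,\mathcal A)^*$ via $\langle g,\varphi\rangle=\int_G\langle g(s),\varphi(s)\rangle\,d\mu(s)$; it contains $C(G,\mathcal A^*)$. For a Banach algebra $B$, $a,b\in B$, $f\in B^*$ and $m,n\in B^{**}$ put $f_a(b)=f(ab)$, ${}_af(b)=f(ba)$, ${}_mf(a)=m(f_a)$, $f_m(a)=m({}_af)$, and define the Arens products on $B^{**}$ by $(m\,\square\, n)(f)=m({}_nf)$ and $(m\diamond n)(f)=n(f_m)$. The (left) topological center of $B^{**}$ is $Z(B^{**})=\{m\in B^{**}: m\,\square\, n=m\diamond n\text{ for all }n\in B^{**}\}$. The (left) topological pseudo-center $Z_s(L^1(G,\mathcal A)^{**})$ is the set of all $m\in L^1(G,\mathcal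 A)^{**}$ such that $(m\,\square\, n)(f)=(m\diamond n)(f)$ for all $n\in L^1(G,\mathcal A)^{**}$ and all $f\in L^\infty(G,\mathcal A^*)$. Let $m\in Z_s(L^1(G,\mathcal A)^{**})$, and suppose that for every $a^*\in\mathcal A^*$ the operator $\Delta_{m,a^*}:C(G)\to\mathcal A^*$, $\Delta_{m,a^*}(f)(a)=m(f\otimes{}_aa^*)$, is compact, where $(f\otimes x^*)(s)=f(s)x^*$. Then the restriction of $m$ to $C(G,\mathcal A^*)$ is given by a regular $Z(\mathcal A^{**})$-valued measure. That is, there is a norm-countably additive measure $\nu$ on the Borel sets of $G$ with values in $\mathcal A^{**}$ such that 1. $\nu$ has bounded variation; 2. $\nu$ is regular: for every Borel set $E$ and every $\varepsilon>0$ there are a closed set $K$ and an open set $U$ with $K\subseteq E\subseteq U$, $|\nu|(E\setminus K)<\varepsilon$ and $|\nu|(U\setminus E)<\varepsilon$, where $|\nu|$ is the variation of $\nu$; 3. $m(F)=\int_G F\,d\nu$ for every $F\in C(G,\mathcal A^*)$, the integral being taken with respect to the evaluation pairing $\mathcal A^*\times\mathcal A^{**}\to\mathbb C$; 4. $\nu(E)\in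 Z(\mathcal A^{**})$ for every Borel set $E\subseteq G$. -/

import Mathlib

open MeasureTheory Filter Topology
open scoped ENNReal

set_option linter.overlappingInstances false
set_option linter.unusedSectionVars false

noncomputable section

namespace ArensMeasure

/-! ### Arens products of a bounded bilinear product -/

section Arens

variable {E : Type*} [NormedAddCommGroup E] [NormedSpace ℂ E]

/-- `a ↦ f_a`, where `f_a b = f (a b)`; the product of `E` is the bounded bilinear map `M`. -/
def dualRight (M : E →L[ℂ] E →L[ℂ] E) (f : StrongDual ℂ E) : E →L[ℂ] StrongDual ℂ E :=
  (ContinuousLinearMap.compL ℂ E E ℂ f) ∘L M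

/-- `a ↦ ₐf`, where `ₐf b = f (b a)`. -/
def dualLeft (M : E →L[ℂ] E →L[ℂ] E) (f : StrongDual ℂ E) : E →L[ℂ] StrongDual ℂ E :=
  (ContinuousLinearMap.compL ℂ E E ℂ f) ∘L M.flip

theorem dualRight_apply (M : E →L[ℂ] E →L[ℂ] E) (f : StrongDual ℂ E) (a b : E) :
    dualRight M f a b = f (M a b) := rfl

theorem dualLeft_apply (M : E →L[ℂ] E →L[ℂ] E) (f : StrongDual ℂ E) (a b : E) :
    dualLeft M f a b = f (M b a) := rfl

/-- The functional `ₘf`, where `ₘf a = m (f_a)`. -/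
def bidualLeft (M : E →L[ℂ] E →L[ℂ] E) (m : StrongDual ℂ (StrongDual ℂ E))
    (f : StrongDual ℂ E) : StrongDual ℂ E :=
  m ∘L dualRight M f

/-- The functional `f_m`, where `f_m a = m (ₐf)`. -/
def bidualRight (M : E →L[ℂ] E →L[ℂ] E) (m : StrongDual ℂ (StrongDual ℂ E))
    (f : StrongDual ℂ E) : StrongDual ℂ E :=
  m ∘L dualLeft M f

theorem norm_bidualLeft_le (M : E →L[ℂ] E →L[ℂ] E) (m : StrongDual ℂ (StrongDual ℂ E))
    (f : StrongDual ℂ E) : ‖bidualLeft M m f‖ ≤ ‖m‖ * ‖M‖ * ‖f‖ := by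
  refine ContinuousLinearMap.opNorm_le_bound _ (by positivity) fun a => ?_
  have h2 : ‖dualRight M f a‖ ≤ ‖f‖ * (‖M‖ * ‖a‖) :=
    (ContinuousLinearMap.opNorm_comp_le f (M a)).trans
      (mul_le_mul_of_nonneg_left (M.le_opNorm a) (norm_nonneg _))
  calc ‖m (dualRight M f a)‖ ≤ ‖m‖ * ‖dualRight M f a‖ := m.le_opNorm _
    _ ≤ ‖m‖ * (‖f‖ * (‖M‖ * ‖a‖)) := mul_le_mul_of_nonneg_left h2 (norm_nonneg m)
    _ = ‖m‖ * ‖M‖ * ‖f‖ * ‖a‖ := by ring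

theorem norm_bidualRight_le (M : E →L[ℂ] E →L[ℂ] E) (m : StrongDual ℂ (StrongDual ℂ E))
    (f : StrongDual ℂ E) : ‖bidualRight M m f‖ ≤ ‖m‖ * ‖M‖ * ‖f‖ := by
  refine ContinuousLinearMap.opNorm_le_bound _ (by positivity) fun a => ?_
  have h2 : ‖dualLeft M f a‖ ≤ ‖f‖ * (‖M‖ * ‖a‖) := by
    refine (ContinuousLinearMap.opNorm_comp_le f (M.flip a)).trans
      (mul_le_mul_of_nonneg_left ?_ (norm_nonneg _))
    simpa using M.flip.le_opNorm a
  calc ‖m (dualLeft M f a)‖ ≤ ‖m‖ * ‖dualLeft M f a‖ := m.le_opNorm _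
    _ ≤ ‖m‖ * (‖f‖ * (‖M‖ * ‖a‖)) := mul_le_mul_of_nonneg_left h2 (norm_nonneg m)
    _ = ‖m‖ * ‖M‖ * ‖f‖ * ‖a‖ := by ring

/-- The first Arens product, `(m □ n) f = m (ₙf)`. -/
def arensBox (M : E →L[ℂ] E →L[ℂ] E) (m n : StrongDual ℂ (StrongDual ℂ E)) :
    StrongDual ℂ (StrongDual ℂ E) :=
  m ∘L LinearMap.mkContinuous
    { toFun := fun f => bidualLeft M n f
      map_add' := fun f g => by
        ext a
        exact map_add n (dualRight M f a) (dualRight M g a)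
      map_smul' := fun c f => by
        ext a
        exact map_smul n c (dualRight M f a) }
    (‖n‖ * ‖M‖) (norm_bidualLeft_le M n)

/-- The second Arens product, `(m ◇ n) f = n (f_m)`. -/
def arensDiamond (M : E →L[ℂ] E →L[ℂ] E) (m n : StrongDual ℂ (StrongDual ℂ E)) :
    StrongDual ℂ (StrongDual ℂ E) :=
  n ∘L LinearMap.mkContinuous
    { toFun := fun f => bidualRight M m f
      map_add' := fun f g => by
        ext a
        exact map_add m (dualLeft M f a) (dualLeft M g a)
      map_smul' := fun c f => by
        ext a
        exact map_smul m c (dualLeft M f a) }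
    (‖m‖ * ‖M‖) (norm_bidualRight_le M m)

theorem arensBox_apply (M : E →L[ℂ] E →L[ℂ] E) (m n : StrongDual ℂ (StrongDual ℂ E))
    (f : StrongDual ℂ E) : arensBox M m n f = m (bidualLeft M n f) := rfl

theorem arensDiamond_apply (M : E →L[ℂ] E →L[ℂ] E) (m n : StrongDual ℂ (StrongDual ℂ E))
    (f : StrongDual ℂ E) : arensDiamond M m n f = n (bidualRight M m f) := rfl

end Arens

/-- The (left) topological center `Z(A**)` of the bidual of a Banach algebra `A`. -/
def topologicalCenter (A : Type*) [NonUnitalNormedRing A] [NormedSpace ℂ A]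
    [IsScalarTower ℂ A A] [SMulCommClass ℂ A A] : Set (StrongDual ℂ (StrongDual ℂ A)) :=
  {m | ∀ n, arensBox (ContinuousLinearMap.mul ℂ A) m n
    = arensDiamond (ContinuousLinearMap.mul ℂ A) m n}

/-! ### The convolution algebra `L¹(G, A)` -/

section Convolution

variable {G : Type*} [Group G] [TopologicalSpace G] [IsTopologicalGroup G] [CompactSpace G]
  [T2Space G] [MeasurableSpace G] [BorelSpace G]
  (μ : Measure G) [μ.IsHaarMeasure] [IsProbabilityMeasure μ] [μ.Regular]

section Translate

variable {X : Type*} [NormedAddCommGroup X]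

/-- Left translation on `L¹(G, X)`: `(translate s ψ) t = ψ (s⁻¹ t)`. -/
def translate (s : G) (ψ : Lp X 1 μ) : Lp X 1 μ := DomMulAct.mk s⁻¹ • ψ

theorem translate_ae_eq (s : G) (ψ : Lp X 1 μ) :
    translate μ s ψ =ᵐ[μ] fun t => ψ (s⁻¹ * t) :=
  DomMulAct.smul_Lp_ae_eq (DomMulAct.mk s⁻¹) ψ

theorem norm_translate (s : G) (ψ : Lp X 1 μ) : ‖translate μ s ψ‖ = ‖ψ‖ :=
  DomMulAct.norm_smul_Lp _ _

theorem continuous_translate (ψ : Lp X 1 μ) : Continuous fun s : G => translate μ s ψ := by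
  have : Fact ((1 : ℝ≥0∞) ≠ ∞) := ⟨ENNReal.one_ne_top⟩
  have h : Continuous fun s : G => DomMulAct.mk s⁻¹ :=
    DomMulAct.continuous_mk.comp continuous_inv
  exact h.smul continuous_const

end Translate

variable {A : Type*} [NonUnitalNormedRing A] [NormedSpace ℂ A]
  [IsScalarTower ℂ A A] [SMulCommClass ℂ A A]

/-- The element `t ↦ φ(s) ψ(s⁻¹ t)` of `L¹(G, A)`. -/
def convIntegrand (φ ψ : Lp A 1 μ) (s : G) : Lp A 1 μ :=
  (ContinuousLinearMap.mul ℂ A).compLpL₂ 1 μ (φ s) (translate μ s ψ)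

theorem convIntegrand_ae_eq (φ ψ : Lp A 1 μ) (s : G) :
    convIntegrand μ φ ψ s =ᵐ[μ] fun t => φ s * ψ (s⁻¹ * t) := by
  filter_upwards [ContinuousLinearMap.coeFn_compLp (ContinuousLinearMap.mul ℂ A (φ s))
    (translate μ s ψ), translate_ae_eq μ s ψ] with t h1 h2
  rw [convIntegrand, ContinuousLinearMap.compLpL₂_apply_apply, h1, h2]
  rfl

theorem norm_convIntegrand_le (φ ψ : Lp A 1 μ) (s : G) :
    ‖convIntegrand μ φ ψ s‖ ≤ ‖φ s‖ * ‖ψ‖ := by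
  have h := ContinuousLinearMap.norm_compLp_le (ContinuousLinearMap.mul ℂ A (φ s))
    (translate μ s ψ)
  rw [norm_translate] at h
  exact h.trans (mul_le_mul_of_nonneg_right (ContinuousLinearMap.opNorm_mul_apply_le ℂ A _)
    (norm_nonneg _))

theorem integrable_convIntegrand (φ ψ : Lp A 1 μ) : Integrable (convIntegrand μ φ ψ) μ := by
  have hφ : Integrable φ μ := L1.integrable_coeFn φ
  refine Integrable.mono' (hφ.norm.mul_const ‖ψ‖) ?_
    (Eventually.of_forall (norm_convIntegrand_le μ φ ψ))
  exact ContinuousLinearMap.aestronglyMeasurable_comp₂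
    ((ContinuousLinearMap.mul ℂ A).compLpL₂ 1 μ) hφ.aestronglyMeasurable
    (continuous_translate μ ψ).aestronglyMeasurable_of_compactSpace

variable [CompleteSpace A]

/-- The convolution `(φ * ψ)(t) = ∫ φ(s) ψ(s⁻¹ t) dμ(s)` as a bounded bilinear map on `L¹(G, A)`.
The integral over `s` is taken as a Bochner integral of `L¹(G, A)`-valued functions, which needs
no measurability on the product `G × G`. -/
def conv : Lp A 1 μ →L[ℂ] Lp A 1 μ →L[ℂ] Lp A 1 μ :=
  LinearMap.mkContinuous₂
    (LinearMap.mk₂ ℂ (fun φ ψ => ∫ s, convIntegrand μ φ ψ s ∂μ)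
      (fun φ φ' ψ => by
        rw [← integral_add (integrable_convIntegrand μ φ ψ) (integrable_convIntegrand μ φ' ψ)]
        refine integral_congr_ae ?_
        filter_upwards [Lp.coeFn_add φ φ'] with s hs
        simp only [convIntegrand, hs, Pi.add_apply, map_add, add_apply])
      (fun c φ ψ => by
        rw [← integral_smul]
        refine integral_congr_ae ?_
        filter_upwards [Lp.coeFn_smul c φ] with s hs
        simp only [convIntegrand, hs, Pi.smul_apply, map_smul, smul_apply])
      (fun φ ψ ψ' => by
        rw [← integral_add (integrable_convIntegrand μ φ ψ) (integrable_convIntegrand μ φ ψ')]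
        refine integral_congr_ae (Eventually.of_forall fun s => ?_)
        simp only [convIntegrand, translate, smul_add, map_add])
      (fun c φ ψ => by
        rw [← integral_smul]
        refine integral_congr_ae (Eventually.of_forall fun s => ?_)
        simp only [convIntegrand, translate, smul_comm _ c ψ, map_smul]))
    1 (fun φ ψ => by
      have h1 : ‖φ‖ = ∫ s, ‖φ s‖ ∂μ := L1.norm_eq_integral_norm φ
      rw [one_mul, h1, ← integral_mul_const]
      exact norm_integral_le_of_norm_le ((L1.integrable_coeFn φ).norm.mul_const ‖ψ‖)
        (Eventually.of_forall (norm_convIntegrand_le μ φ ψ)))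

theorem conv_apply (φ ψ : Lp A 1 μ) : conv μ φ ψ = ∫ s, convIntegrand μ φ ψ s ∂μ := rfl

end Convolution

/-! ### `C(G, A*) ⊆ L^∞(G, A*) ⊆ L¹(G, A)*` -/

section Embeddings

variable {G : Type*} [TopologicalSpace G] [CompactSpace G] [MeasurableSpace G] [BorelSpace G]
  (μ : Measure G) [IsProbabilityMeasure μ]

theorem memLp_of_continuous {X : Type*} [NormedAddCommGroup X] (p : ℝ≥0∞) (F : C(G, X)) :
    MemLp F p μ :=
  MemLp.of_bound F.continuous.aestronglyMeasurable_of_compactSpace ‖F‖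
    (Eventually.of_forall fun s => F.norm_coe_le_norm s)

/-- The class of a continuous function in `L^p`. -/
def toLp {X : Type*} [NormedAddCommGroup X] [NormedSpace ℂ X] (p : ℝ≥0∞) [Fact (1 ≤ p)] :
    C(G, X) →L[ℂ] Lp X p μ :=
  LinearMap.mkContinuous
    { toFun := fun F => (memLp_of_continuous μ p F).toLp F
      map_add' := fun _ _ => rfl
      map_smul' := fun _ _ => rfl }
    1 (fun F => by
      have h := Lp.norm_le_of_ae_bound (f := (memLp_of_continuous μ p F).toLp F) (norm_nonneg F)
        (by
          filter_upwards [(memLp_of_continuous μ p F).coeFn_toLp] with s hs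
          rw [hs]
          exact F.norm_coe_le_norm s)
      have h1 : measureUnivNNReal μ = 1 := by simp [measureUnivNNReal]
      rw [h1, NNReal.coe_one, Real.one_rpow] at h
      exact h)

theorem toLp_ae_eq {X : Type*} [NormedAddCommGroup X] [NormedSpace ℂ X] (p : ℝ≥0∞)
    [Fact (1 ≤ p)] (F : C(G, X)) : toLp μ p F =ᵐ[μ] F :=
  (memLp_of_continuous μ p F).coeFn_toLp

variable {A : Type*} [NormedAddCommGroup A] [NormedSpace ℂ A]

/-- The canonical map `L^∞(G, A*) → L¹(G, A)*`, `g ↦ (φ ↦ ∫ ⟨g(s), φ(s)⟩ dμ(s))`. -/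
def linftyToDual : Lp (StrongDual ℂ A) ∞ μ →L[ℂ] StrongDual ℂ (Lp A 1 μ) :=
  (ContinuousLinearMap.id ℂ (StrongDual ℂ A)).lpPairing μ ∞ 1

theorem linftyToDual_apply (g : Lp (StrongDual ℂ A) ∞ μ) (φ : Lp A 1 μ) :
    linftyToDual μ g φ = ∫ s, g s (φ s) ∂μ :=
  ContinuousLinearMap.lpPairing_eq_integral _ g φ

/-- The restriction of `m ∈ L¹(G, A)**` to `C(G, A*)`. -/
def restrictC (m : StrongDual ℂ (StrongDual ℂ (Lp A 1 μ))) :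
    StrongDual ℂ C(G, StrongDual ℂ A) :=
  m ∘L linftyToDual μ ∘L toLp μ ∞

end Embeddings

section ConvolutionFormula

variable {G : Type*} [Group G] [TopologicalSpace G] [IsTopologicalGroup G] [CompactSpace G]
  [T2Space G] [MeasurableSpace G] [BorelSpace G]
  (μ : Measure G) [μ.IsHaarMeasure] [IsProbabilityMeasure μ] [μ.Regular]
  {A : Type*} [NonUnitalNormedRing A] [NormedSpace ℂ A]
  [IsScalarTower ℂ A A] [SMulCommClass ℂ A A] [CompleteSpace A]

/-- The pointwise formula for the convolution with a continuous function. Continuous functions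
being dense in `L¹(G, A)`, it determines the bounded bilinear map `conv`. -/
theorem conv_toLp_ae_eq (φ : Lp A 1 μ) (F : C(G, A)) :
    conv μ φ (toLp μ 1 F) =ᵐ[μ] fun t => ∫ s, φ s * F (s⁻¹ * t) ∂μ := by
  let T : C(G, C(G, A)) :=
    ContinuousMap.curry ⟨fun p : G × G => F (p.1⁻¹ * p.2), by fun_prop⟩
  let B : A →L[ℂ] C(G, A) →L[ℂ] C(G, A) :=
    LinearMap.mkContinuous₂
      (LinearMap.mk₂ ℂ (fun a H => (⟨fun t => a * H t, by fun_prop⟩ : C(G, A)))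
        (fun a b H => by ext t; simp [add_mul])
        (fun c a H => by ext t; exact smul_mul_assoc c a (H t))
        (fun a H K => by ext t; simp [mul_add])
        (fun c a H => by ext t; exact mul_smul_comm c a (H t)))
      1 (fun a H => by
        rw [one_mul, ContinuousMap.norm_le _ (by positivity)]
        intro t
        exact (norm_mul_le _ _).trans
          (mul_le_mul_of_nonneg_left (H.norm_coe_le_norm t) (norm_nonneg _)))
  have hBT : ∀ s t, B (φ s) (T s) t = φ s * F (s⁻¹ * t) := fun s t => rfl
  have hφ : Integrable φ μ := L1.integrable_coeFn φ
  have hint : Integrable (fun s => B (φ s) (T s)) μ := by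
    refine Integrable.mono' (hφ.norm.mul_const ‖F‖) ?_ (Eventually.of_forall fun s => ?_)
    · exact ContinuousLinearMap.aestronglyMeasurable_comp₂ B hφ.aestronglyMeasurable
        T.continuous.aestronglyMeasurable_of_compactSpace
    · rw [ContinuousMap.norm_le _ (by positivity)]
      intro t
      exact (norm_mul_le _ _).trans
        (mul_le_mul_of_nonneg_left (F.norm_coe_le_norm _) (norm_nonneg _))
  have h1 : conv μ φ (toLp μ 1 F) = toLp μ 1 (∫ s, B (φ s) (T s) ∂μ) := by
    rw [conv_apply, ← ContinuousLinearMap.integral_comp_comm _ hint]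
    refine integral_congr_ae (Eventually.of_forall fun s => Lp.ext ?_)
    have hqmp : Measure.QuasiMeasurePreserving (fun t => s⁻¹ * t) μ μ :=
      (measurePreserving_mul_left μ s⁻¹).quasiMeasurePreserving
    filter_upwards [convIntegrand_ae_eq μ φ (toLp μ 1 F) s, toLp_ae_eq μ 1 (B (φ s) (T s)),
      hqmp.ae_eq_comp (toLp_ae_eq μ 1 F)] with t h2 h3 h4
    simp only [Function.comp_apply] at h4
    rw [h2, h3, h4, hBT]
  rw [h1]
  filter_upwards [toLp_ae_eq μ 1 (∫ s, B (φ s) (T s) ∂μ)] with t ht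
  rw [ht]
  have h5 := ContinuousLinearMap.integral_comp_comm
    (ContinuousMap.evalCLM ℂ t : C(G, A) →L[ℂ] A) hint
  exact h5.symm

end ConvolutionFormula

section Tensor

variable {G : Type*} [TopologicalSpace G] [CompactSpace G]
  {X : Type*} [NormedAddCommGroup X] [NormedSpace ℂ X]

/-- `(f ⊗ x)(s) = f(s) x`, as a bounded bilinear map. -/
def tensor : C(G, ℂ) →L[ℂ] X →L[ℂ] C(G, X) :=
  LinearMap.mkContinuous₂
    (LinearMap.mk₂ ℂ (fun f x => (⟨fun s => f s • x, by fun_prop⟩ : C(G, X)))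
      (fun f g x => by ext s; simp [add_smul])
      (fun c f x => by ext s; simp [mul_smul])
      (fun f x y => by ext s; simp)
      (fun c f x => by ext s; simp [smul_comm c]))
    1 (fun f x => by
      rw [one_mul, ContinuousMap.norm_le _ (by positivity)]
      intro s
      simp only [LinearMap.mk₂_apply, ContinuousMap.coe_mk, norm_smul]
      exact mul_le_mul_of_nonneg_right (f.norm_coe_le_norm s) (norm_nonneg _))

theorem tensor_apply (f : C(G, ℂ)) (x : X) (s : G) : tensor f x s = f s • x := rfl

end Tensor

/-! ### The pseudo-center and the maps `Δ` -/

/-- The (left) topological pseudo-center `Z_s(L¹(G, A)**)`: all `m` with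
`(m □ n) f = (m ◇ n) f` for every `n ∈ L¹(G, A)**` and every `f ∈ L^∞(G, A*)`. -/
def pseudoCenter {G : Type*} [Group G] [TopologicalSpace G] [IsTopologicalGroup G]
    [CompactSpace G] [T2Space G] [MeasurableSpace G] [BorelSpace G]
    (μ : Measure G) [μ.IsHaarMeasure] [IsProbabilityMeasure μ] [μ.Regular]
    (A : Type*) [NonUnitalNormedRing A] [NormedSpace ℂ A]
    [IsScalarTower ℂ A A] [SMulCommClass ℂ A A] [CompleteSpace A] :
    Set (StrongDual ℂ (StrongDual ℂ (Lp A 1 μ))) :=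
  {m | ∀ (n : StrongDual ℂ (StrongDual ℂ (Lp A 1 μ))) (f : Lp (StrongDual ℂ A) ∞ μ),
    arensBox (conv μ) m n (linftyToDual μ f) = arensDiamond (conv μ) m n (linftyToDual μ f)}

/-- The map `Δ_{m,a*} : C(G) → A*`, `Δ_{m,a*}(f)(a) = m(f ⊗ ₐa*)`. -/
def Delta {G : Type*} [TopologicalSpace G] [CompactSpace G] [MeasurableSpace G] [BorelSpace G]
    (μ : Measure G) [IsProbabilityMeasure μ]
    {A : Type*} [NonUnitalNormedRing A] [NormedSpace ℂ A]
    [IsScalarTower ℂ A A] [SMulCommClass ℂ A A]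
    (m : StrongDual ℂ (StrongDual ℂ (Lp A 1 μ))) (a' : StrongDual ℂ A) (f : C(G, ℂ)) :
    StrongDual ℂ A :=
  restrictC μ m ∘L tensor f ∘L dualLeft (ContinuousLinearMap.mul ℂ A) a'

/-! ### Regular vector measures -/

/-- Vector measures with values in a normed space, countably additive in norm. -/
abbrev NormedVectorMeasure (S X : Type*) [MeasurableSpace S] [NormedAddCommGroup X] :=
  VectorMeasure S X

/-- A vector measure is regular if every measurable `E` is approximated in variation by closed
sets from inside and by open sets from outside. -/
def IsRegularVM {S X : Type*} [TopologicalSpace S] [MeasurableSpace S]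
    [NormedAddCommGroup X] (ν : NormedVectorMeasure S X) : Prop :=
  ∀ E, MeasurableSet E → ∀ ε : ℝ≥0∞, 0 < ε → ∃ K U, IsClosed K ∧ IsOpen U ∧ K ⊆ E ∧ E ⊆ U ∧
    ν.variation (E \ K) < ε ∧ ν.variation (U \ E) < ε

/-- The evaluation pairing `X × X* → ℂ`. -/
def evalPairing (X : Type*) [NormedAddCommGroup X] [NormedSpace ℂ X] :
    X →L[ℝ] StrongDual ℂ X →L[ℝ] ℂ :=
  (ContinuousLinearMap.id ℂ (StrongDual ℂ X)).flip.bilinearRestrictScalars ℝ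

theorem evalPairing_apply (X : Type*) [NormedAddCommGroup X] [NormedSpace ℂ X]
    (x : X) (x' : StrongDual ℂ X) : evalPairing X x x' = x' x := rfl

end ArensMeasure

end

open scoped NNReal CompactlySupported

noncomputable section

namespace ArensMeasure

/-! The measure comes from Singer's theorem. A bounded functional `Λ` on `C(K, X)` has a total
variation, which is additive on nonnegative functions and hence, by Riesz, a finite regular measure
`l` with `‖Λ F‖ ≤ ∫ ‖F‖ dl`. By Hahn–Banach `Λ` extends to `L¹(l, X)`, which yields an operator `T :
L¹(l) → X*`, and `ν E = T 1_E` satisfies `‖ν E‖ ≤ l E`. This single bound gives norm-countable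
additivity, bounded variation and regularity (`exists_regular_representation`).

For the center, let `n ∈ A**`. Since Haar measure charges open sets, `F ↦ n (F 1)` on `C(G, A*)`
extends to some `k ∈ L¹(G, A)**` (`exists_point_lift`). For `f = g ⊗ a*` one computes `ₖf = g ⊗
ₙa*`, while `f_m` is the continuous function `u ↦ Δ_{m,a*}(g(· u))`. The pseudo-center identity for
`k` and `f` therefore reads `m(g ⊗ ₙa*) = n(Δ_{m,a*} g)` (`restrictC_tensor_bidualLeft`). Written
through `T`, both sides are continuous in the `L¹(l)` norm of `g`. By density of `C(G)` one may put
`g = 1_E`, which is `(ν E □ n)(a*) = (ν E ◇ n)(a*)`. -/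

theorem nnnorm_ofReal_coe (c : ℝ≥0) : ‖((c : ℝ) : ℂ)‖₊ = c := NNReal.eq (by simp)

/-! ### Total variation of a functional on `C(K, X)` -/

section Dominating

variable {K : Type*} [TopologicalSpace K] [CompactSpace K]
  {X : Type*} [NormedAddCommGroup X] [NormedSpace ℂ X]

/-- The total variation of a functional `Λ` on `C(K, X)`, evaluated at `f ≥ 0`: the supremum of
`‖Λ F‖` over all `F` with `‖F‖ ≤ f` pointwise. -/
def dominatedSup (Λ : StrongDual ℂ C(K, X)) (f : C_c(K, ℝ≥0)) : ℝ≥0 :=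
  ⨆ F : {F : C(K, X) // ∀ s, ‖F s‖₊ ≤ f s}, ‖Λ F‖₊

theorem dominatedSup_le {Λ : StrongDual ℂ C(K, X)} {f : C_c(K, ℝ≥0)} {c : ℝ≥0}
    (h : ∀ F : C(K, X), (∀ s, ‖F s‖₊ ≤ f s) → ‖Λ F‖₊ ≤ c) : dominatedSup Λ f ≤ c := by
  have : Nonempty {F : C(K, X) // ∀ s, ‖F s‖₊ ≤ f s} := ⟨0, fun s => by simp⟩
  exact ciSup_le fun F => h F F.2

theorem nnnorm_le_dominatedSup (Λ : StrongDual ℂ C(K, X)) {f : C_c(K, ℝ≥0)} {F : C(K, X)}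
    (h : ∀ s, ‖F s‖₊ ≤ f s) : ‖Λ F‖₊ ≤ dominatedSup Λ f := by
  -- An unbounded supremum in `ℝ≥0` would be the default value `0`; compactness of `K` bounds `f`,
  -- hence all competitors.
  have hb : BddAbove (Set.range fun F : {F : C(K, X) // ∀ s, ‖F s‖₊ ≤ f s} => ‖Λ F‖₊) := by
    obtain ⟨C, hC⟩ := (isCompact_range f.continuous).bddAbove
    refine ⟨‖Λ‖₊ * C, ?_⟩
    rintro _ ⟨⟨H, hH⟩, rfl⟩
    refine (Λ.le_opNNNorm H).trans (mul_le_mul_right ?_ _)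
    rw [← NNReal.coe_le_coe, coe_nnnorm, ContinuousMap.norm_le _ C.coe_nonneg]
    exact fun s => (hH s).trans (hC ⟨s, rfl⟩)
  exact le_ciSup hb ⟨F, h⟩

/-- Unimodular factors `c`, `d` make `Λ (c • F)` and `Λ (d • H)` nonnegative, so the norms add up,
and `c • F + d • H` is still dominated by `f + g`. -/
theorem dominatedSup_add_le (Λ : StrongDual ℂ C(K, X)) (f g : C_c(K, ℝ≥0)) :
    dominatedSup Λ f + dominatedSup Λ g ≤ dominatedSup Λ (f + g) := by
  have key : ∀ F : C(K, X), (∀ s, ‖F s‖₊ ≤ f s) → ∀ H : C(K, X), (∀ s, ‖H s‖₊ ≤ g s) →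
      ‖Λ F‖₊ + ‖Λ H‖₊ ≤ dominatedSup Λ (f + g) := by
    intro F hF H hH
    obtain ⟨c, hc, hcF⟩ := RCLike.exists_norm_eq_mul_self (Λ F)
    obtain ⟨d, hd, hdH⟩ := RCLike.exists_norm_eq_mul_self (Λ H)
    have hc' : ‖c‖₊ = 1 := NNReal.eq hc
    have hd' : ‖d‖₊ = 1 := NNReal.eq hd
    have h1 : ‖Λ (c • F + d • H)‖₊ = ‖Λ F‖₊ + ‖Λ H‖₊ := by
      apply NNReal.eq
      rw [map_add, map_smul, map_smul, smul_eq_mul, smul_eq_mul, ← hcF, ← hdH]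
      rw [coe_nnnorm, ← RCLike.ofReal_add,
        RCLike.norm_of_nonneg (add_nonneg (norm_nonneg _) (norm_nonneg _))]
      rfl
    rw [← h1]
    refine nnnorm_le_dominatedSup Λ fun s => ?_
    refine (nnnorm_add_le _ _).trans ?_
    rw [ContinuousMap.smul_apply, ContinuousMap.smul_apply, nnnorm_smul, nnnorm_smul, hc', hd',
      one_mul, one_mul]
    exact add_le_add (hF s) (hH s)
  have h2 : ∀ H : C(K, X), (∀ s, ‖H s‖₊ ≤ g s) →
      dominatedSup Λ f + ‖Λ H‖₊ ≤ dominatedSup Λ (f + g) := by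
    intro H hH
    -- Truncated subtraction needs `‖Λ H‖₊` to be at most the right-hand side, which is `key` for `F
    -- = 0`.
    refine add_le_of_le_tsub_right_of_le
      (le_add_self.trans (key 0 (fun s => by simp) H hH)) (dominatedSup_le fun F hF => ?_)
    exact le_tsub_of_add_le_right (key F hF H hH)
  refine add_le_of_le_tsub_left_of_le
    (le_self_add.trans (h2 0 (fun s => by simp))) (dominatedSup_le fun H hH => ?_)
  exact le_tsub_of_add_le_left (h2 H hH)

/-- `F` is split with the weights `f / (f + g + ε)`, `g / (f + g + ε)` and `ε / (f + g + ε)`. The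
`ε` keeps the weights continuous where `f + g` vanishes, and the third piece costs at most `‖Λ‖ ε`.
-/
theorem le_dominatedSup_add (Λ : StrongDual ℂ C(K, X)) (f g : C_c(K, ℝ≥0)) :
    dominatedSup Λ (f + g) ≤ dominatedSup Λ f + dominatedSup Λ g := by
  refine dominatedSup_le fun F hF => ?_
  have key : ∀ ε : ℝ≥0, 0 < ε →
      ‖Λ F‖₊ ≤ dominatedSup Λ f + dominatedSup Λ g + ‖Λ‖₊ * ε := by
    intro ε hε
    have hpos : ∀ s, f s + g s + ε ≠ 0 := fun s => by positivity
    have hcut : ∀ h : C(K, ℝ≥0), Continuous fun s =>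
        ((h s / (f s + g s + ε) : ℝ≥0) : ℂ) • F s := by
      intro h
      have h1 : Continuous fun s => h s / (f s + g s + ε) :=
        h.continuous.div ((f.continuous.add g.continuous).add continuous_const) hpos
      have h2 : Continuous fun s => ((h s / (f s + g s + ε) : ℝ≥0) : ℂ) :=
        Complex.continuous_ofReal.comp (NNReal.continuous_coe.comp h1)
      exact h2.smul F.continuous
    let cut : C(K, ℝ≥0) → C(K, X) := fun h => ⟨_, hcut h⟩
    have hnorm : ∀ (h : C(K, ℝ≥0)) s, ‖cut h s‖₊ ≤ h s := by
      intro h s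
      have h1 : ‖cut h s‖₊ = h s / (f s + g s + ε) * ‖F s‖₊ := by
        change ‖((h s / (f s + g s + ε) : ℝ≥0) : ℂ) • F s‖₊ = _
        rw [nnnorm_smul, nnnorm_ofReal_coe]
      rw [h1, div_mul_eq_mul_div]
      refine NNReal.div_le_of_le_mul (mul_le_mul_right ?_ _)
      exact (hF s).trans le_self_add
    have hsum : F = cut f.toContinuousMap + cut g.toContinuousMap + cut (.const K ε) := by
      ext s
      change F s = ((f s / (f s + g s + ε) : ℝ≥0) : ℂ) • F s
        + ((g s / (f s + g s + ε) : ℝ≥0) : ℂ) • F s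
        + ((ε / (f s + g s + ε) : ℝ≥0) : ℂ) • F s
      rw [← add_smul, ← add_smul, ← Complex.ofReal_add, ← Complex.ofReal_add,
        ← NNReal.coe_add, ← NNReal.coe_add, ← add_div, ← add_div, div_self (hpos s)]
      simp
    calc ‖Λ F‖₊ ≤ ‖Λ (cut f.toContinuousMap)‖₊ + ‖Λ (cut g.toContinuousMap)‖₊
          + ‖Λ (cut (.const K ε))‖₊ := by
          conv_lhs => rw [hsum, map_add, map_add]
          exact (nnnorm_add_le _ _).trans (add_le_add_left (nnnorm_add_le _ _) _)
      _ ≤ _ := by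
          refine add_le_add (add_le_add ?_ ?_) ?_
          · exact nnnorm_le_dominatedSup Λ (hnorm _)
          · exact nnnorm_le_dominatedSup Λ (hnorm _)
          · refine (Λ.le_opNNNorm _).trans (mul_le_mul_right ?_ _)
            rw [← NNReal.coe_le_coe, coe_nnnorm, ContinuousMap.norm_le _ ε.coe_nonneg]
            exact fun s => hnorm _ s
  have hlim : Tendsto (fun ε : ℝ≥0 => dominatedSup Λ f + dominatedSup Λ g + ‖Λ‖₊ * ε) (𝓝[>] 0)
      (𝓝 (dominatedSup Λ f + dominatedSup Λ g)) := by
    have h : Continuous fun ε : ℝ≥0 => dominatedSup Λ f + dominatedSup Λ g + ‖Λ‖₊ * ε := by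
      fun_prop
    simpa using (h.tendsto 0).mono_left nhdsWithin_le_nhds
  exact ge_of_tendsto hlim (eventually_mem_nhdsWithin.mono key)

theorem mul_dominatedSup_le (Λ : StrongDual ℂ C(K, X)) (c : ℝ≥0) (f : C_c(K, ℝ≥0)) :
    c * dominatedSup Λ f ≤ dominatedSup Λ (c • f) := by
  rcases eq_or_ne c 0 with rfl | hc
  · simp
  rw [← le_inv_mul_iff₀ (pos_iff_ne_zero.2 hc)]
  refine dominatedSup_le fun F hF => ?_
  rw [le_inv_mul_iff₀ (pos_iff_ne_zero.2 hc)]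
  have h1 : c * ‖Λ F‖₊ = ‖Λ (((c : ℝ) : ℂ) • F)‖₊ := by
    rw [map_smul, nnnorm_smul, nnnorm_ofReal_coe]
  rw [h1]
  refine nnnorm_le_dominatedSup Λ fun s => ?_
  rw [ContinuousMap.smul_apply, nnnorm_smul, nnnorm_ofReal_coe]
  exact mul_le_mul_right (hF s) c

theorem dominatedSup_smul (Λ : StrongDual ℂ C(K, X)) (c : ℝ≥0) (f : C_c(K, ℝ≥0)) :
    dominatedSup Λ (c • f) = c * dominatedSup Λ f := by
  refine le_antisymm ?_ (mul_dominatedSup_le Λ c f)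
  rcases eq_or_ne c 0 with rfl | hc
  · refine dominatedSup_le fun F hF => ?_
    have h0 : F = 0 := by
      ext s
      simpa using hF s
    simp [h0]
  -- The reverse inequality is the one already known, for the scalar `c⁻¹` and the function `c • f`.
  · have h := mul_dominatedSup_le Λ c⁻¹ (c • f)
    rw [smul_smul, inv_mul_cancel₀ hc, one_smul] at h
    calc dominatedSup Λ (c • f) = c * (c⁻¹ * dominatedSup Λ (c • f)) := by
          rw [← mul_assoc, mul_inv_cancel₀ hc, one_mul]
      _ ≤ c * dominatedSup Λ f := mul_le_mul_right h c

/-- A bounded functional on `C(K, X)` is dominated by the `L¹`-norm of a finite regular measure. -/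
theorem exists_dominating_measure [T2Space K] [MeasurableSpace K] [BorelSpace K]
    (Λ : StrongDual ℂ C(K, X)) :
    ∃ l : Measure K, IsFiniteMeasure l ∧ l.Regular ∧ ∀ F : C(K, X), ‖Λ F‖ ≤ ∫ s, ‖F s‖ ∂l := by
  let D : C_c(K, ℝ≥0) →ₗ[ℝ≥0] ℝ≥0 :=
    { toFun := dominatedSup Λ
      map_add' := fun f g => le_antisymm (le_dominatedSup_add Λ f g) (dominatedSup_add_le Λ f g)
      map_smul' := dominatedSup_smul Λ }
  refine ⟨NNRealRMK.rieszMeasure D, ⟨isCompact_univ.measure_lt_top⟩, inferInstance, fun F => ?_⟩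
  let f : C_c(K, ℝ≥0) :=
    ⟨⟨fun s => ‖F s‖₊, F.continuous.nnnorm⟩, HasCompactSupport.of_compactSpace _⟩
  have h := NNRealRMK.integral_rieszMeasure D f
  have h1 : ‖Λ F‖₊ ≤ D f := nnnorm_le_dominatedSup Λ fun s => le_rfl
  calc ‖Λ F‖ ≤ D f := h1
    _ = _ := h.symm

end Dominating

/-! ### Extension to `L¹` and the vector measure of an operator on `L¹` -/

/-- The Hahn–Banach theorem for a functional that is bounded relative to a linear map `J`. -/
theorem exists_strongDual_factor {E F : Type*} [AddCommGroup E] [Module ℂ E]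
    [NormedAddCommGroup F] [NormedSpace ℂ F] (J : E →ₗ[ℂ] F) (g : E →ₗ[ℂ] ℂ) (C : ℝ) (hC : 0 ≤ C)
    (h : ∀ x, ‖g x‖ ≤ C * ‖J x‖) :
    ∃ k : StrongDual ℂ F, ‖k‖ ≤ C ∧ ∀ x, k (J x) = g x := by
  -- By the bound, `g` vanishes on the kernel of `J`, so it descends to the range of `J`, where it
  -- has norm at most `C`.
  have happ : ∀ x, g.compLeftInverse J ⟨J x, ⟨x, rfl⟩⟩ = g x := fun x =>
    LinearMap.compLeftInverse_apply_of_bdd g J ⟨C, h⟩ x _ rfl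
  obtain ⟨k, hk, hnorm⟩ := exists_extension_norm_eq (LinearMap.range J) (g.compLeftInverse J)
  refine ⟨k, ?_, fun x => ?_⟩
  · rw [hnorm]
    refine ContinuousLinearMap.opNorm_le_bound _ hC ?_
    rintro ⟨_, x, rfl⟩
    rw [happ x]
    exact h x
  · rw [← happ x]
    exact hk ⟨J x, ⟨x, rfl⟩⟩

section L1Functional

variable {K : Type*} [MeasurableSpace K] {l : Measure K}
  {X : Type*} [NormedAddCommGroup X] [NormedSpace ℂ X]

/-- For `L ∈ L¹(l, X)*`, the operator `g ↦ (x ↦ L (g ⊗ x))` from `L¹(l)` to `X*`. -/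
def tensorDual (L : StrongDual ℂ (Lp X 1 l)) : Lp ℂ 1 l →L[ℂ] StrongDual ℂ X :=
  (ContinuousLinearMap.compL ℂ X (Lp X 1 l) ℂ L) ∘L
    (ContinuousLinearMap.compLpL₂ 1 l (ContinuousLinearMap.lsmul ℂ ℂ).flip).flip

theorem tensorDual_apply (L : StrongDual ℂ (Lp X 1 l)) (g : Lp ℂ 1 l) (x : X) :
    tensorDual L g x = L (((ContinuousLinearMap.lsmul ℂ ℂ).flip x : ℂ →L[ℂ] X).compLp g) := rfl

theorem tensorDual_apply_of_ae_eq (L : StrongDual ℂ (Lp X 1 l)) (g : Lp ℂ 1 l) (x : X)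
    (h : Lp X 1 l) (hh : h =ᵐ[l] fun s => g s • x) : tensorDual L g x = L h := by
  rw [tensorDual_apply]
  congr 1
  refine Lp.ext ?_
  filter_upwards [hh, ContinuousLinearMap.coeFn_compLp
    ((ContinuousLinearMap.lsmul ℂ ℂ).flip x : ℂ →L[ℂ] X) g] with s h1 h2
  rw [h1, h2]
  rfl

theorem norm_tensorDual_le (L : StrongDual ℂ (Lp X 1 l)) (hL : ‖L‖ ≤ 1) (g : Lp ℂ 1 l) :
    ‖tensorDual L g‖ ≤ ‖g‖ := by
  refine ContinuousLinearMap.opNorm_le_bound _ (norm_nonneg _) fun x => ?_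
  have h2 : ‖((ContinuousLinearMap.lsmul ℂ ℂ).flip x : ℂ →L[ℂ] X)‖ ≤ ‖x‖ :=
    ContinuousLinearMap.opNorm_le_bound _ (norm_nonneg _) fun c => by
      simp [norm_smul, mul_comm]
  calc ‖tensorDual L g x‖
      ≤ ‖L‖ * ‖((ContinuousLinearMap.lsmul ℂ ℂ).flip x : ℂ →L[ℂ] X).compLp g‖ := L.le_opNorm _
    _ ≤ 1 * (‖x‖ * ‖g‖) := by
        gcongr
        exact (ContinuousLinearMap.norm_compLp_le _ g).trans (by gcongr)
    _ = ‖g‖ * ‖x‖ := by ring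

variable [IsFiniteMeasure l]

theorem tensorDual_indicator (L : StrongDual ℂ (Lp X 1 l)) {E : Set K} (hE : MeasurableSet E)
    (x : X) : tensorDual L (indicatorConstLp 1 hE (measure_ne_top l E) 1) x
      = L (indicatorConstLp 1 hE (measure_ne_top l E) x) := by
  refine tensorDual_apply_of_ae_eq L _ x _ ?_
  filter_upwards [indicatorConstLp_coeFn (p := 1) (hs := hE) (hμs := measure_ne_top l E) (c := x),
    indicatorConstLp_coeFn (p := 1) (hs := hE) (hμs := measure_ne_top l E) (c := (1 : ℂ))]
    with s h1 h2
  rw [h1, h2]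
  by_cases hs : s ∈ E <;> simp [hs]

/-- A contraction `T : L¹(l) → Y` defines the vector measure `E ↦ T 1_E`. -/
theorem exists_vectorMeasure {Y : Type*} [NormedAddCommGroup Y] [NormedSpace ℂ Y] [CompleteSpace Y]
    (T : Lp ℂ 1 l →L[ℂ] Y) (hT : ∀ g, ‖T g‖ ≤ ‖g‖) :
    ∃ ν : NormedVectorMeasure K Y, (∀ E, ‖ν E‖ₑ ≤ l E) ∧
      ∀ E (hE : MeasurableSet E), ν E = T (indicatorConstLp 1 hE (measure_ne_top l E) 1) := by
  classical
  let w : Set K → Y := fun E =>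
    if hE : MeasurableSet E then T (indicatorConstLp 1 hE (measure_ne_top l E) 1) else 0
  have hw : ∀ E (hE : MeasurableSet E),
      w E = T (indicatorConstLp 1 hE (measure_ne_top l E) 1) := fun E hE => dif_pos hE
  have hle : ∀ E, ‖w E‖ₑ ≤ l E := by
    intro E
    by_cases hE : MeasurableSet E
    · rw [hw E hE]
      have h1 := (hT _).trans
        (norm_indicatorConstLp_le (p := 1) (hs := hE) (hμs := measure_ne_top l E) (c := (1 : ℂ)))
      rw [← ofReal_norm]
      refine ENNReal.ofReal_le_of_le_toReal (h1.trans_eq ?_)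
      simp [Measure.real]
    · simp [w, hE]
  have hadd : ∀ s t, MeasurableSet s → MeasurableSet t → Disjoint s t → w (s ∪ t) = w s + w t := by
    intro s t hs ht hst
    rw [hw s hs, hw t ht, hw _ (hs.union ht), ← map_add,
      indicatorConstLp_disjoint_union hs ht (measure_ne_top l s) (measure_ne_top l t) hst]
  -- Finite additivity becomes countable additivity in norm because the tails are dominated by the
  -- finite measure `l`.
  exact ⟨VectorMeasure.of_additive_of_le_measure w hle hadd fun E hE => dif_neg hE, hle, hw⟩

/-- Both sides are additive and continuous for the `L¹(l)` norm, and they agree on multiples of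
indicators. -/
theorem integral_vectorMeasure_eq {Y : Type*} [NormedAddCommGroup Y] [NormedSpace ℝ Y]
    (L : StrongDual ℂ (Lp X 1 l)) (ν : VectorMeasure K Y) (B : X →L[ℝ] Y →L[ℝ] ℂ)
    (hle : ∀ E, ‖ν E‖ₑ ≤ l E)
    (hν : ∀ E (hE : MeasurableSet E) x, B x (ν E) = L (indicatorConstLp 1 hE (measure_ne_top l E) x))
    {f : K → X} (hf : Integrable f l) : ν.integral f B = L (hf.toL1 f) := by
  have hvar : ν.variation ≤ l :=
    VectorMeasure.variation_le_of_forall_enorm_le (μ := ν) fun E _ => hle E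
  have hdom : DominatedFinMeasAdditive l (ν.transpose B) ‖B‖ := by
    refine ⟨fun s t hs ht _ _ hst => cbmApplyMeasure_union ν _ hs ht hst, fun s hs hsf => ?_⟩
    refine (norm_cbmApplyMeasure_le ν _ s).trans (mul_le_mul_of_nonneg_left ?_ B.opNorm_nonneg)
    rw [← toReal_enorm]
    exact ENNReal.toReal_mono hsf.ne (hle s)
  -- The integral against `ν` is an extension from simple functions over the variation of `ν`; as
  -- this is at most `l`, integrable functions for `l` give the same value when the extension is
  -- made over `l`.
  have hint : ∀ {g : K → X}, Integrable g l →
      ν.integral g B = setToFun l (ν.transpose B) hdom g := fun hg =>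
    (setToFun_congr_measure_of_integrable 1 ENNReal.one_ne_top (by simpa using hvar) _ _ _ hg).symm
  rw [hint hf]
  suffices H : ∀ g : K → X, Integrable g l → ∀ hg : Integrable g l,
      setToFun l (ν.transpose B) hdom g = L (hg.toL1 g) from H f hf hf
  intro g hg
  refine Integrable.induction (μ := l) (P := fun g => ∀ hg : Integrable g l,
      setToFun l (ν.transpose B) hdom g = L (hg.toL1 g)) ?_ ?_ ?_ ?_ hg
  · intro x E hE _ hg
    rw [setToFun_indicator_const hdom hE (measure_ne_top l E) x]
    exact hν E hE x
  · intro f g _ hf hg h1 h2 hfg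
    rw [setToFun_add hdom hf hg, h1 hf, h2 hg, ← map_add]
    rfl
  · have h1 : {f : Lp X 1 l | ∀ hf : Integrable f l,
        setToFun l (ν.transpose B) hdom f = L (hf.toL1 f)}
        = {f : Lp X 1 l | setToFun l (ν.transpose B) hdom f = L f} := by
      ext f
      refine ⟨fun h => ?_, fun h hf => ?_⟩
      · rw [Set.mem_ofPred_eq, h (L1.integrable_coeFn f), Integrable.toL1_coeFn]
      · rw [Integrable.toL1_coeFn]
        exact h
    rw [h1]
    exact isClosed_eq (continuous_setToFun hdom) L.continuous
  · intro f g hfg hf h1 hg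
    rw [← setToFun_congr_ae hdom hfg, h1 hf, (Integrable.toL1_eq_toL1_iff f g hf hg).2 hfg]

end L1Functional

/-! ### Regularity and Singer's theorem -/

theorem isRegularVM_of_enorm_le {S X : Type*} [TopologicalSpace S] [MeasurableSpace S]
    [R1Space S] [BorelSpace S] [NormedAddCommGroup X] (ν : NormedVectorMeasure S X) (l : Measure S)
    [IsFiniteMeasure l] [l.Regular] (hle : ∀ E, ‖ν E‖ₑ ≤ l E) : IsRegularVM ν := by
  have hvar : ν.variation ≤ l := VectorMeasure.variation_le_of_forall_enorm_le fun E _ => hle E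
  intro E hE ε hε
  obtain ⟨K, hKE, hK, hK'⟩ := hE.exists_isClosed_sdiff_lt (μ := l) (measure_ne_top l E) hε.ne'
  obtain ⟨U, hEU, hU, -, hU'⟩ := hE.exists_isOpen_sdiff_lt (μ := l) (measure_ne_top l E) hε.ne'
  exact ⟨K, U, hK, hU, hKE, hEU, (hvar _).trans_lt hK', (hvar _).trans_lt hU'⟩

/-- Singer's theorem: a bounded functional on `C(K, X)` is integration against a regular
`X*`-valued measure `ν` of bounded variation. Moreover `ν` is dominated by a finite regular measure
`l`, and `E ↦ ν E` extends to a bounded operator `L¹(l) → X*`. -/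
theorem exists_regular_representation {K : Type*} [TopologicalSpace K] [CompactSpace K] [T2Space K]
    [MeasurableSpace K] [BorelSpace K] {X : Type*} [NormedAddCommGroup X] [NormedSpace ℂ X]
    (Λ : StrongDual ℂ C(K, X)) :
    ∃ (ν : NormedVectorMeasure K (StrongDual ℂ X)) (l : Measure K) (_ : IsFiniteMeasure l)
      (_ : l.Regular) (T : Lp ℂ 1 l →L[ℂ] StrongDual ℂ X),
      (∀ E, ‖ν E‖ₑ ≤ l E) ∧ (∀ F : C(K, X), Λ F = ν.integral F (evalPairing X)) ∧
      (∀ E (hE : MeasurableSet E), ν E = T (indicatorConstLp 1 hE (measure_ne_top l E) 1)) ∧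
      ∀ (g : C(K, ℂ)) (x : X), T (ContinuousMap.toLp 1 l ℂ g) x = Λ (tensor g x) := by
  obtain ⟨l, hfin, hreg, hl⟩ := exists_dominating_measure Λ
  have hint : ∀ F : C(K, X), Integrable F l := fun F =>
    Integrable.of_bound F.continuous.aestronglyMeasurable_of_compactSpace ‖F‖
      (Eventually.of_forall F.norm_coe_le_norm)
  let J : C(K, X) →ₗ[ℂ] Lp X 1 l :=
    { toFun := fun F => (hint F).toL1 F
      map_add' := fun F H => Integrable.toL1_add F H (hint F) (hint H)
      map_smul' := fun c F => Integrable.toL1_smul F (hint F) c }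
  -- Since `‖J F‖ = ∫ ‖F‖ dl`, domination by `l` is boundedness relative to `J` with constant `1`.
  obtain ⟨L, hL, hLJ⟩ := exists_strongDual_factor J (Λ : C(K, X) →ₗ[ℂ] ℂ) 1 zero_le_one (by
    intro F
    have h1 : ‖J F‖ = ∫ s, ‖F s‖ ∂l := L1.norm_of_fun_eq_integral_norm (hint F)
    rw [one_mul, h1]
    exact hl F)
  obtain ⟨ν, hle, hν⟩ := exists_vectorMeasure (tensorDual L) (norm_tensorDual_le L hL)
  refine ⟨ν, l, hfin, hreg, tensorDual L, hle, fun F => ?_, hν, fun g x => ?_⟩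
  · refine ((integral_vectorMeasure_eq L ν (evalPairing X) hle (fun E hE x => ?_) (hint F)).trans
      (hLJ F)).symm
    rw [evalPairing_apply, hν E hE, tensorDual_indicator]
  · refine (tensorDual_apply_of_ae_eq L _ x (J (tensor g x)) ?_).trans (hLJ _)
    filter_upwards [(hint (tensor g x)).coeFn_toL1, ContinuousMap.coeFn_toLp (𝕜 := ℂ) (p := 1) l g]
      with s h1 h2
    rw [h2, ← tensor_apply]
    exact h1

/-! ### Continuous functions as functionals on `L¹(G, A)` -/

section ContDual

variable {G : Type*} [TopologicalSpace G] [CompactSpace G] [MeasurableSpace G] [BorelSpace G]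
  (μ : Measure G) [IsProbabilityMeasure μ]
  {A : Type*} [NormedAddCommGroup A] [NormedSpace ℂ A]

/-- The canonical map `C(G, A*) → L¹(G, A)*`. -/
def contDual : C(G, StrongDual ℂ A) →L[ℂ] StrongDual ℂ (Lp A 1 μ) :=
  linftyToDual μ ∘L toLp μ ∞

theorem restrictC_apply (m : StrongDual ℂ (StrongDual ℂ (Lp A 1 μ))) (F : C(G, StrongDual ℂ A)) :
    restrictC μ m F = m (contDual μ F) := rfl

theorem contDual_apply (F : C(G, StrongDual ℂ A)) (φ : Lp A 1 μ) :
    contDual μ F φ = ∫ s, F s (φ s) ∂μ := by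
  refine (linftyToDual_apply μ _ φ).trans (integral_congr_ae ?_)
  filter_upwards [toLp_ae_eq μ ∞ F] with s hs
  exact DFunLike.congr_fun hs (φ s)

/-- Testing against `1_U ⊗ x`, for a neighbourhood `U` of `t` on which `F s x` is `ε`-close to `F t
x`, recovers `F t x` up to `ε`, as `U` has positive measure. Hence evaluation at a point is bounded
for the norm of `L¹(G, A)*`. -/
theorem norm_apply_le_norm_contDual [μ.IsOpenPosMeasure] (F : C(G, StrongDual ℂ A)) (t : G) :
    ‖F t‖ ≤ ‖contDual μ F‖ := by
  refine ContinuousLinearMap.opNorm_le_bound _ (norm_nonneg _) fun x => ?_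
  refine le_of_forall_pos_le_add fun ε hε => ?_
  have hcont : Continuous fun s => F s x := by fun_prop
  let U : Set G := {s | ‖F s x - F t x‖ < ε}
  have hU : IsOpen U := isOpen_lt (by fun_prop) continuous_const
  have htU : t ∈ U := by simpa [U] using hε
  have hpos : 0 < μ.real U :=
    ENNReal.toReal_pos (hU.measure_pos μ ⟨t, htU⟩).ne' (measure_ne_top μ U)
  have hUm : MeasurableSet U := hU.measurableSet
  have hint : Integrable (fun s => F s x) μ :=
    Integrable.of_bound hcont.aestronglyMeasurable_of_compactSpace (‖F‖ * ‖x‖)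
      (Eventually.of_forall fun s =>
        ((F s).le_opNorm x).trans (by gcongr; exact F.norm_coe_le_norm s))
  have h1 : contDual μ F (indicatorConstLp 1 hUm (measure_ne_top μ U) x) = ∫ s in U, F s x ∂μ := by
    rw [contDual_apply, ← integral_indicator hUm]
    refine integral_congr_ae ?_
    filter_upwards [indicatorConstLp_coeFn (p := 1) (hs := hUm) (hμs := measure_ne_top μ U)
      (c := x)] with s hs
    rw [hs]
    by_cases hsU : s ∈ U <;> simp [hsU]
  have h2 : ‖∫ s in U, F s x ∂μ‖ ≤ ‖contDual μ F‖ * (‖x‖ * μ.real U) := by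
    rw [← h1]
    refine ((contDual μ F).le_opNorm _).trans (mul_le_mul_of_nonneg_left ?_ (norm_nonneg _))
    simpa using norm_indicatorConstLp_le (p := 1) (hs := hUm) (hμs := measure_ne_top μ U) (c := x)
  have h3 : ‖∫ s in U, (F s x - F t x) ∂μ‖ ≤ ε * μ.real U :=
    norm_setIntegral_le_of_norm_le_const (measure_lt_top μ U) fun s hs => le_of_lt hs
  have h4 : ∫ s in U, (F s x - F t x) ∂μ = ∫ s in U, F s x ∂μ - μ.real U • F t x := by
    rw [integral_sub hint.integrableOn (integrable_const _), setIntegral_const]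
  have h5 : μ.real U * ‖F t x‖ ≤ μ.real U * (‖contDual μ F‖ * ‖x‖ + ε) := by
    calc μ.real U * ‖F t x‖ = ‖μ.real U • F t x‖ := by
          rw [norm_smul, Real.norm_of_nonneg hpos.le]
      _ = ‖∫ s in U, F s x ∂μ - ∫ s in U, (F s x - F t x) ∂μ‖ := by rw [h4, sub_sub_cancel]
      _ ≤ ‖contDual μ F‖ * (‖x‖ * μ.real U) + ε * μ.real U := (norm_sub_le _ _).trans (by gcongr)
      _ = _ := by ring
  exact le_of_mul_le_mul_left h5 hpos

/-- The functional `F ↦ n (F t)` on `C(G, A*)` extends to an element of `L¹(G, A)**`. -/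
theorem exists_point_lift [μ.IsOpenPosMeasure] (n : StrongDual ℂ (StrongDual ℂ A)) (t : G) :
    ∃ k : StrongDual ℂ (StrongDual ℂ (Lp A 1 μ)),
      ∀ F : C(G, StrongDual ℂ A), k (contDual μ F) = n (F t) := by
  let g : C(G, StrongDual ℂ A) →ₗ[ℂ] ℂ :=
    { toFun := fun F => n (F t)
      map_add' := fun F H => map_add n (F t) (H t)
      map_smul' := fun c F => map_smul n c (F t) }
  have hg : ∀ F, ‖g F‖ ≤ ‖n‖ * ‖(contDual μ).toLinearMap F‖ := fun F =>
    (n.le_opNorm (F t)).trans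
      (mul_le_mul_of_nonneg_left (norm_apply_le_norm_contDual μ F t) (norm_nonneg n))
  obtain ⟨k, -, hk⟩ := exists_strongDual_factor (contDual μ).toLinearMap g ‖n‖ (norm_nonneg n) hg
  exact ⟨k, hk⟩

theorem norm_tensor_le {X : Type*} [NormedAddCommGroup X] [NormedSpace ℂ X] (f : C(G, ℂ)) (x : X) :
    ‖tensor f x‖ ≤ ‖f‖ * ‖x‖ := by
  rw [ContinuousMap.norm_le _ (by positivity)]
  intro s
  rw [tensor_apply, norm_smul]
  exact mul_le_mul_of_nonneg_right (f.norm_coe_le_norm s) (norm_nonneg _)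

theorem integrable_tensor {X : Type*} [NormedAddCommGroup X] [NormedSpace ℂ X]
    (T : C(G, C(G, ℂ))) (R : A →L[ℂ] X) (φ : Lp A 1 μ) :
    Integrable (fun s => tensor (T s) (R (φ s))) μ := by
  have hR : Integrable (fun s => R (φ s)) μ := R.integrable_comp (L1.integrable_coeFn φ)
  have hT : AEStronglyMeasurable T μ := T.continuous.aestronglyMeasurable_of_compactSpace
  have hmeas : AEStronglyMeasurable (fun s => tensor (T s) (R (φ s))) μ :=
    (tensor : C(G, ℂ) →L[ℂ] X →L[ℂ] C(G, X)).aestronglyMeasurable_comp₂ hT hR.aestronglyMeasurable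
  refine Integrable.mono' (hR.norm.const_mul ‖T‖) hmeas (Eventually.of_forall fun s => ?_)
  exact (norm_tensor_le (T s) (R (φ s))).trans
    (mul_le_mul_of_nonneg_right (T.norm_coe_le_norm s) (norm_nonneg _))

/-- This replaces Fubini: the integral is taken in `C(G, A*)`, and evaluations, pairings and `m`
itself are bounded functionals there. -/
theorem map_integral_tensor (Φ : StrongDual ℂ C(G, StrongDual ℂ A)) (T : C(G, C(G, ℂ)))
    (R : A →L[ℂ] StrongDual ℂ A) (φ : Lp A 1 μ) :
    Φ (∫ s, tensor (T s) (R (φ s)) ∂μ) = ∫ s, Φ (tensor (T s) (R (φ s))) ∂μ :=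
  (ContinuousLinearMap.integral_comp_comm Φ (integrable_tensor μ T R φ)).symm

theorem contDual_integral_tensor_apply (T : C(G, C(G, ℂ)))
    (R : A →L[ℂ] StrongDual ℂ A) (φ ψ : Lp A 1 μ) :
    contDual μ (∫ s, tensor (T s) (R (φ s)) ∂μ) ψ
      = ∫ s, contDual μ (tensor (T s) (R (φ s))) ψ ∂μ :=
  map_integral_tensor μ (ContinuousLinearMap.apply ℂ ℂ ψ ∘L contDual μ) T R φ

theorem integral_tensor_apply (T : C(G, C(G, ℂ)))
    (R : A →L[ℂ] StrongDual ℂ A) (φ : Lp A 1 μ) (n : StrongDual ℂ (StrongDual ℂ A)) (u : G) :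
    n ((∫ s, tensor (T s) (R (φ s)) ∂μ : C(G, StrongDual ℂ A)) u)
      = ∫ s, n (T s u • R (φ s)) ∂μ :=
  map_integral_tensor μ
    (n ∘L (ContinuousMap.evalCLM ℂ u : C(G, StrongDual ℂ A) →L[ℂ] StrongDual ℂ A)) T R φ

end ContDual

theorem continuous_comp_tensor_comp {G : Type*} [TopologicalSpace G] [CompactSpace G]
    {A : Type*} [NormedAddCommGroup A] [NormedSpace ℂ A]
    {X : Type*} [NormedAddCommGroup X] [NormedSpace ℂ X]
    (Λ : StrongDual ℂ C(G, X)) (D : A →L[ℂ] X) :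
    Continuous fun f : C(G, ℂ) => Λ ∘L tensor f ∘L D := by
  have h1 : Continuous fun f : C(G, ℂ) => (tensor f : X →L[ℂ] C(G, X)) := tensor.continuous
  exact continuous_const.clm_comp (h1.clm_comp continuous_const)

/-! ### Arens products on `g ⊗ a*` and the topological center -/

section Center

variable {G : Type*} [Group G] [TopologicalSpace G] [IsTopologicalGroup G] [CompactSpace G]

/-- The left translates `s ↦ (u ↦ g (s u))`. -/
def leftTranslates (g : C(G, ℂ)) : C(G, C(G, ℂ)) :=
  ContinuousMap.curry ⟨fun p : G × G => g (p.1 * p.2), by fun_prop⟩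

/-- The right translates `u ↦ (s ↦ g (s u))`. -/
def rightTranslates (g : C(G, ℂ)) : C(G, C(G, ℂ)) :=
  ContinuousMap.curry ⟨fun p : G × G => g (p.2 * p.1), by fun_prop⟩

theorem leftTranslates_apply (g : C(G, ℂ)) (s u : G) : leftTranslates g s u = g (s * u) := rfl

theorem rightTranslates_apply (g : C(G, ℂ)) (u s : G) : rightTranslates g u s = g (s * u) := rfl

variable [T2Space G] [MeasurableSpace G] [BorelSpace G]
  (μ : Measure G) [μ.IsHaarMeasure] [IsProbabilityMeasure μ] [μ.Regular]
  {A : Type*} [NonUnitalNormedRing A] [NormedSpace ℂ A]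
  [IsScalarTower ℂ A A] [SMulCommClass ℂ A A] [CompleteSpace A]

/-- Left invariance of `μ` under the substitution `t = s u`. -/
theorem contDual_tensor_convIntegrand (g : C(G, ℂ)) (a' : StrongDual ℂ A) (φ ψ : Lp A 1 μ) (s : G) :
    contDual μ (tensor g a') (convIntegrand μ φ ψ s)
      = contDual μ (tensor (leftTranslates g s)
          (dualRight (ContinuousLinearMap.mul ℂ A) a' (φ s))) ψ := by
  rw [contDual_apply, contDual_apply,
    ← integral_mul_left_eq_self (fun u => tensor (leftTranslates g s)
      (dualRight (ContinuousLinearMap.mul ℂ A) a' (φ s)) u (ψ u)) s⁻¹]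
  refine integral_congr_ae ?_
  filter_upwards [convIntegrand_ae_eq μ φ ψ s] with t ht
  rw [ht, tensor_apply, tensor_apply, leftTranslates_apply, mul_inv_cancel_left]
  rfl

/-- The functional `f_φ` is thus again a continuous function, so an element of the bidual acts on it
through its restriction to `C(G, A*)`. -/
theorem dualRight_conv_contDual (g : C(G, ℂ)) (a' : StrongDual ℂ A) (φ : Lp A 1 μ) :
    dualRight (conv μ) (contDual μ (tensor g a')) φ
      = contDual μ (∫ s, tensor (leftTranslates g s)
          (dualRight (ContinuousLinearMap.mul ℂ A) a' (φ s)) ∂μ) := by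
  ext ψ
  rw [dualRight_apply, conv_apply, contDual_integral_tensor_apply,
    ← ContinuousLinearMap.integral_comp_comm (contDual μ (tensor g a'))
      (integrable_convIntegrand μ φ ψ)]
  exact integral_congr_ae (Eventually.of_forall (contDual_tensor_convIntegrand μ g a' φ ψ))

theorem dualLeft_conv_contDual (g : C(G, ℂ)) (a' : StrongDual ℂ A) (ψ : Lp A 1 μ) :
    dualLeft (conv μ) (contDual μ (tensor g a')) ψ
      = contDual μ (∫ u, tensor (rightTranslates g u)
          (dualLeft (ContinuousLinearMap.mul ℂ A) a' (ψ u)) ∂μ) := by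
  ext φ
  rw [dualLeft_apply, ← dualRight_apply, dualRight_conv_contDual, contDual_apply,
    contDual_integral_tensor_apply]
  refine integral_congr_ae (Eventually.of_forall fun u => ?_)
  refine (integral_tensor_apply μ (leftTranslates g)
    (dualRight (ContinuousLinearMap.mul ℂ A) a') φ
    (ContinuousLinearMap.apply ℂ ℂ (ψ u)) u).trans ?_
  exact (contDual_apply μ (tensor (rightTranslates g u)
    (dualLeft (ContinuousLinearMap.mul ℂ A) a' (ψ u))) φ).symm

/-- At the identity the translate `g (s u)` becomes `g s`, a scalar that leaves `n`; what remains is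
`n (a*_{φ(s)})`, the value of `ₙa*` at `φ s`. -/
theorem bidualLeft_conv_contDual (g : C(G, ℂ)) (a' : StrongDual ℂ A)
    (n : StrongDual ℂ (StrongDual ℂ A)) (k : StrongDual ℂ (StrongDual ℂ (Lp A 1 μ)))
    (hk : ∀ F : C(G, StrongDual ℂ A), k (contDual μ F) = n (F 1)) :
    bidualLeft (conv μ) k (contDual μ (tensor g a'))
      = contDual μ (tensor g (bidualLeft (ContinuousLinearMap.mul ℂ A) n a')) := by
  ext φ
  change k (dualRight (conv μ) (contDual μ (tensor g a')) φ) = _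
  rw [dualRight_conv_contDual, hk, contDual_apply, integral_tensor_apply]
  refine integral_congr_ae (Eventually.of_forall fun s => ?_)
  change n (leftTranslates g s 1 • _) = _
  rw [map_smul, leftTranslates_apply, mul_one]
  rfl

theorem continuous_delta (m : StrongDual ℂ (StrongDual ℂ (Lp A 1 μ))) (a' : StrongDual ℂ A) :
    Continuous (Delta μ m a') :=
  continuous_comp_tensor_comp (restrictC μ m) (dualLeft (ContinuousLinearMap.mul ℂ A) a')

/-- The continuous function `u ↦ Δ_{m,a*}(s ↦ g (s u))`. -/
def deltaTranslates (m : StrongDual ℂ (StrongDual ℂ (Lp A 1 μ))) (a' : StrongDual ℂ A)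
    (g : C(G, ℂ)) : C(G, StrongDual ℂ A) :=
  ⟨fun u => Delta μ m a' (rightTranslates g u), 
    (continuous_delta μ m a').comp (rightTranslates g).continuous⟩

/-- As `f_m` is a continuous function, the lift of a point evaluation can be computed on it. -/
theorem bidualRight_conv_contDual (m : StrongDual ℂ (StrongDual ℂ (Lp A 1 μ)))
    (g : C(G, ℂ)) (a' : StrongDual ℂ A) :
    bidualRight (conv μ) m (contDual μ (tensor g a'))
      = contDual μ (deltaTranslates μ m a' g) := by
  ext ψ
  change m (dualLeft (conv μ) (contDual μ (tensor g a')) ψ) = _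
  rw [dualLeft_conv_contDual, contDual_apply]
  exact map_integral_tensor μ (m ∘L contDual μ) (rightTranslates g)
    (dualLeft (ContinuousLinearMap.mul ℂ A) a') ψ

/-- The pseudo-center identity is tested on the lift of `F ↦ n (F 1)`; this is the only use of
membership in the pseudo-center. -/
theorem restrictC_tensor_bidualLeft {m : StrongDual ℂ (StrongDual ℂ (Lp A 1 μ))}
    (hm : m ∈ pseudoCenter μ A) (n : StrongDual ℂ (StrongDual ℂ A)) (g : C(G, ℂ))
    (a' : StrongDual ℂ A) :
    restrictC μ m (tensor g (bidualLeft (ContinuousLinearMap.mul ℂ A) n a'))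
      = n (Delta μ m a' g) := by
  obtain ⟨k, hk⟩ := exists_point_lift μ n (1 : G)
  have h1 : m (bidualLeft (conv μ) k (contDual μ (tensor g a')))
      = k (bidualRight (conv μ) m (contDual μ (tensor g a'))) := hm k (toLp μ ∞ (tensor g a'))
  rw [bidualLeft_conv_contDual μ g a' n k hk, bidualRight_conv_contDual, hk] at h1
  rw [restrictC_apply, h1]
  have h2 : rightTranslates g 1 = g := by
    ext s
    rw [rightTranslates_apply, mul_one]
  change n (Delta μ m a' (rightTranslates g 1)) = _
  rw [h2]

/-- The restriction to `C(G, A*)` of an element of the pseudo-center is given by a regular measure of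
bounded variation with values in the topological center. The representing measure of a functional
on `C(G, A*)` is always norm-countably additive, so no compactness of the maps `Δ` is needed. -/
theorem exists_regular_measure_mem_topologicalCenter
    {m : StrongDual ℂ (StrongDual ℂ (Lp A 1 μ))}
    (hm : m ∈ pseudoCenter μ A) :
    ∃ ν : NormedVectorMeasure G (StrongDual ℂ (StrongDual ℂ A)),
      ν.variation Set.univ < ∞ ∧
      IsRegularVM ν ∧
      (∀ F : C(G, StrongDual ℂ A), restrictC μ m F
        = ν.integral F (evalPairing (StrongDual ℂ A))) ∧
      ∀ E : Set G, MeasurableSet E → ν E ∈ topologicalCenter A := by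
  obtain ⟨ν, l, hfin, hreg, T, hle, hint, hν, hT⟩ := exists_regular_representation (restrictC μ m)
  refine ⟨ν, ?_, isRegularVM_of_enorm_le ν l hle, hint, fun E hE n => ?_⟩
  · exact (VectorMeasure.variation_le_of_forall_enorm_le (fun E _ => hle E) Set.univ).trans_lt
      (measure_lt_top l _)
  ext a'
  rw [arensBox_apply, arensDiamond_apply, hν E hE]
  -- On `h ∈ L¹(l)` these are `p h = T h (ₙa*)` and `q h = n (a ↦ T h (ₐa*))`. At `h = 1_E` they are
  -- the two Arens products of `ν E` and `n` at `a*`, and on the dense subspace `C(G)` they agree by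
  -- the pseudo-center identity.
  let p : Lp ℂ 1 l →L[ℂ] ℂ :=
    ContinuousLinearMap.apply ℂ ℂ (bidualLeft (ContinuousLinearMap.mul ℂ A) n a') ∘L T
  let q : Lp ℂ 1 l →L[ℂ] ℂ :=
    n ∘L (ContinuousLinearMap.compL ℂ A (StrongDual ℂ A) ℂ).flip
      (dualLeft (ContinuousLinearMap.mul ℂ A) a') ∘L T
  have hpq : (p : Lp ℂ 1 l → ℂ) = q := by
    refine (ContinuousMap.toLp_denseRange ℂ l ℂ ENNReal.one_ne_top).equalizer
      p.continuous q.continuous (funext fun g => ?_)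
    have h1 : p (ContinuousMap.toLp 1 l ℂ g)
        = restrictC μ m (tensor g (bidualLeft (ContinuousLinearMap.mul ℂ A) n a')) := hT g _
    have h2 : q (ContinuousMap.toLp 1 l ℂ g) = n (Delta μ m a' g) := by
      change n _ = n _
      congr 1
      ext a
      exact hT g _
    change p (ContinuousMap.toLp 1 l ℂ g) = q (ContinuousMap.toLp 1 l ℂ g)
    rw [h1, h2, restrictC_tensor_bidualLeft μ hm]
  exact congrFun hpq _

end Center

end ArensMeasure

end

theorem mainTheorem6
    {G : Type*} [Group G] [TopologicalSpace G] [IsTopologicalGroup G]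
    [CompactSpace G] [T2Space G] [MeasurableSpace G] [BorelSpace G]
    (μ : Measure G) [μ.IsHaarMeasure] [IsProbabilityMeasure μ] [μ.Regular]
    {A : Type*} [NonUnitalNormedRing A] [NormedSpace ℂ A]
    [IsScalarTower ℂ A A] [SMulCommClass ℂ A A] [CompleteSpace A]
    (m : StrongDual ℂ (StrongDual ℂ (Lp A 1 μ)))
    (hm : m ∈ ArensMeasure.pseudoCenter μ A)
    (hΔ : ∀ a' : StrongDual ℂ A, IsCompactOperator (ArensMeasure.Delta μ m a')) :
    ∃ ν : ArensMeasure.NormedVectorMeasure G (StrongDual ℂ (StrongDual ℂ A)),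
      ν.variation Set.univ < ∞ ∧
      ArensMeasure.IsRegularVM ν ∧
      (∀ F : C(G, StrongDual ℂ A), ArensMeasure.restrictC μ m F
        = ν.integral F (ArensMeasure.evalPairing (StrongDual ℂ A))) ∧
      ∀ E : Set G, MeasurableSet E → ν E ∈ ArensMeasure.topologicalCenter A :=
  ArensMeasure.exists_regular_measure_mem_topologicalCenter μ hm
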